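/- Let $(E,d)$ be a Polish space with its Borel $\sigma$-algebra, let $\mathcal M(E)$ be the set of Borel probability measures on $E$, and write $B(z,\epsilon)=\{y\in E: d(z,y)<\epsilon\}$. Let $\{P_t\}_{t\ge 0}$ be a (homogeneous) Markov–Feller semigroup on $E$: a family of Markov transition kernels $P_t(x,\cdot)$ with $P_0(x,\cdot)=\delta_x$ and $P_{s+t}(x,A)=\int_E P_t(y,A)\,P_s(x,dy)$ for all $s,t\ge 0$, such that $P_tf(x):=\int_E f(y)\,P_t(x,dy)$ is continuous in $x$ for every $t\ge0$ and every bounded continuous $f:E\to\mathbb R$. For $\nu\in\mathcal M(E)$ put $P_t^*\nu(A)=\int_E P_t(x,A)\,\nu(dx)$; a measure $\mu\in\mathcal M(E)$ is invariant if $P_t^*\mu=\mu$ for all $t\ge0$. Below, $\sup_{\|f\|_\infty=1}$ is the supremum over all Borel measurable $f:E\to\mathbb R$ with $\|f\|_\infty=\sup_{x}|f(x)|=1$, and for $\mu_1,\mu_2\in\mathcal M(E)$ $$\|\mu_1-\mu_2\|_{TV}=\tfrac12\sup_{\|f\|_\infty=1}\Big|\int_E f\,d\mu_1-\int_E f\,d\mu_2\Big|.$$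 The semigroup is $TV$-eventually continuous at $z\in E$ if $$\limsup_{x\to z}\ \limsup_{t\to\infty}\ \sup_{\|f\|_\infty=1}|P_tf(x)-P_tf(z)|=0.$$ **Theorem 2.1.** The following two statements are equivalent: (1) $\{P_t\}_{t\ge0}$ has a unique invariant measure $\mu\in\mathcal M(E)$, and $\lim_{t\to\infty}\|P_t^*\nu-\mu\|_{TV}=0$ for every $\nu\in\mathcal M(E)$. (2) There exists $z\in E$ such that $\{P_t\}_{t\ge0}$ is $TV$-eventually continuous at $z$ and, for every $\epsilon>0$, $$\inf_{x\in E}\ \liminf_{t\to\infty}P_t(x,B(z,\epsilon))>0.$$ -/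

import Mathlib

open MeasureTheory ProbabilityTheory Filter Topology
open scoped NNReal ENNReal BoundedContinuousFunction

/-- The set of bounded measurable functions `f : E → ℝ` with `‖f‖_∞ = sup_x |f x| = 1`. -/
def unitBorelFunctions (E : Type*) [MeasurableSpace E] : Set (E → ℝ) :=
  {f | Measurable f ∧ ⨆ x, ‖f x‖ₑ = 1}

/-- The total variation distance
`(1/2) * sup_{‖f‖_∞ = 1} |∫ f dμ₁ - ∫ f dμ₂|` of two probability measures. -/
noncomputable def tvDist {E : Type*} [MeasurableSpace E] (μ₁ μ₂ : ProbabilityMeasure E) : ℝ≥0∞ :=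
  2⁻¹ * ⨆ f ∈ unitBorelFunctions E,
    ENNReal.ofReal |(∫ x, f x ∂(μ₁ : Measure E)) - ∫ x, f x ∂(μ₂ : Measure E)|

/-- A homogeneous Markov-Feller semigroup `(P_t)_{t ≥ 0}` on `E`, given by its transition
probabilities `P_t(x, ·)`: Markov kernels with `P_0 = id`, the Chapman-Kolmogorov (semigroup)
property, and the Feller property `P_t (C_b(E)) ⊆ C_b(E)`. -/
structure MarkovFellerSemigroup (E : Type*) [TopologicalSpace E] [MeasurableSpace E] where
  /-- the transition probabilities: `kernel t x A` is `P_t(x, A)` -/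
  kernel : ℝ≥0 → Kernel E E
  isMarkovKernel : ∀ t, IsMarkovKernel (kernel t)
  kernel_zero : kernel 0 = Kernel.id
  kernel_add : ∀ s t, kernel (s + t) = kernel t ∘ₖ kernel s
  feller : ∀ (t : ℝ≥0) (f : E →ᵇ ℝ), Continuous fun x => ∫ y, f y ∂(kernel t x)

namespace MarkovFellerSemigroup

variable {E : Type*} [TopologicalSpace E] [MeasurableSpace E]

instance (P : MarkovFellerSemigroup E) (t : ℝ≥0) : IsMarkovKernel (P.kernel t) :=
  P.isMarkovKernel t

/-- The action `P_t f (x) = ∫ f(y) P_t(x, dy)` on functions. -/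
noncomputable def act (P : MarkovFellerSemigroup E) (t : ℝ≥0) (f : E → ℝ) (x : E) : ℝ :=
  ∫ y, f y ∂(P.kernel t x)

/-- The dual semigroup `P_t^* ν = ∫ P_t(x, ·) ν(dx)` on probability measures. -/
noncomputable def dual (P : MarkovFellerSemigroup E) (t : ℝ≥0) (ν : ProbabilityMeasure E) :
    ProbabilityMeasure E :=
  ⟨(ν : Measure E).bind (P.kernel t), inferInstance⟩

theorem dual_apply (P : MarkovFellerSemigroup E) (t : ℝ≥0) (ν : ProbabilityMeasure E)
    {A : Set E} (hA : MeasurableSet A) :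
    (P.dual t ν : Measure E) A = ∫⁻ x, P.kernel t x A ∂(ν : Measure E) :=
  Measure.bind_apply hA (P.kernel t).measurable.aemeasurable

/-- `μ` is an invariant (probability) measure: `P_t^* μ = μ` for all `t ≥ 0`. -/
def IsInvariant (P : MarkovFellerSemigroup E) (μ : ProbabilityMeasure E) : Prop :=
  ∀ t, P.dual t μ = μ

/-- `TV`-eventual continuity at `z`:
`limsup_{x → z} limsup_{t → ∞} sup_{‖f‖_∞ = 1} |P_t f (x) - P_t f (z)| = 0`.
The suprema and upper limits are taken in `[0, ∞]`. The point `x = z`, where the inner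
expression vanishes, does not affect the value. -/
def TVEventuallyContinuousAt (P : MarkovFellerSemigroup E) (z : E) : Prop :=
  limsup (fun x => limsup (fun t : ℝ≥0 =>
    ⨆ f ∈ unitBorelFunctions E, ENNReal.ofReal |P.act t f x - P.act t f z|) atTop) (𝓝 z) = 0

end MarkovFellerSemigroup

/-!
Why the equivalence holds.

If all laws converge to `μ` in total variation, then any point `z` of the support of `μ` works:
`P_t(x, ·)` and `P_t(z, ·)` have the same limit, and `P_t(x, B(z, ε))` tends to `μ(B(z, ε)) > 0`.

Conversely, let `z` be as in the second statement. There are two steps.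

*Merging.* The total variation distance of `P_t^* ν₁` and `P_t^* ν₂` tends to `0` for all `ν₁`, `ν₂`.
Given `η`, eventual continuity provides a ball `B` around `z` such that laws started in `B`
eventually differ by at most a multiple of `η`. By Fatou's lemma any law eventually gives mass at
least `θ > 0` to `B`. Hence if every two laws eventually differ by at most `r`, then they
eventually differ by at most `θ * (4 * η) + (1 - θ) * r`, since the parts in `B` merge up to
`4 * η` and the rest up to `r` (`exists_dominatedUpTo_step`). Iterating, `r` drops to `5 * η`.

*Existence of an invariant measure.* Merging alone does not suffice: the laws could spread out. Let
`π` be the weighted sum of the laws `P_n(z, ·)`. The support of `π` is a Baire space, covered by the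
sets of points `x` such that `P_k(x, ·)` dominates `P_k(z, ·)` up to `1 / 2`. These sets are closed
by the Feller property, so one of them contains a nonempty relatively open set `V`
(`exists_ball_inter_support_subset`). The trajectory from `z` visits `V` with probability bounded
below, because it does so for small balls around `z`. After each visit, `k` units of time later, a
fixed fraction of the mass lies below `P_k(z, ·)`, hence below a multiple of `π`
(`exists_eventually_le_inf_occupation`). The truncations `P_n(z, ·) ⊓ 2 ^ k • π` then have
countably additive setwise limits along an ultrafilter, nonzero for large `k`, and their supremum
over `k` is invariant for `P_1` since `P_{n+1}(z, ·)` and `P_n(z, ·)` merge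
(`exists_invariant_of_le_inf`). Merging makes it invariant for all `P_t`, unique, and the limit of
all laws.
-/

/-! ### The total variation distance through `[0, 1]`-valued test functions -/

/-- `DominatedUpTo δ μ ν` says that `∫ f dμ ≤ ∫ f dν + δ` for every measurable `f` with values in
`[0, 1]`. For probability measures this means that their total variation distance, normalised to
be at most `1`, is at most `δ`. -/
def DominatedUpTo {E : Type*} [MeasurableSpace E] (δ : ℝ≥0∞) (μ ν : Measure E) : Prop :=
  ∀ f : E → ℝ≥0∞, Measurable f → (∀ x, f x ≤ 1) → ∫⁻ x, f x ∂μ ≤ ∫⁻ x, f x ∂ν + δ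

namespace DominatedUpTo

variable {E : Type*} [MeasurableSpace E] {δ δ' : ℝ≥0∞} {μ ν ρ μ' ν' : Measure E}

theorem mono (h : DominatedUpTo δ μ ν) (hδ : δ ≤ δ') : DominatedUpTo δ' μ ν :=
  fun f hf h1 => (h f hf h1).trans (by gcongr)

theorem trans (h : DominatedUpTo δ μ ν) (h' : DominatedUpTo δ' ν ρ) :
    DominatedUpTo (δ + δ') μ ρ := fun f hf h1 => by
  calc ∫⁻ x, f x ∂μ ≤ ∫⁻ x, f x ∂ν + δ := h f hf h1
    _ ≤ ∫⁻ x, f x ∂ρ + δ' + δ := by gcongr; exact h' f hf h1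
    _ = _ := by ring

theorem measure_le (h : DominatedUpTo δ μ ν) {A : Set E} (hA : MeasurableSet A) :
    μ A ≤ ν A + δ := by
  have := h (A.indicator 1) (measurable_one.indicator hA)
    (fun x => Set.indicator_le_self' (by simp) x)
  simpa [lintegral_indicator_one hA] using this

theorem of_isProbabilityMeasure [IsProbabilityMeasure μ] : DominatedUpTo 1 μ ν :=
  fun f _ h1 => by
    calc ∫⁻ x, f x ∂μ ≤ ∫⁻ _, 1 ∂μ := lintegral_mono h1
      _ = 1 := by simp
      _ ≤ _ := le_add_self

theorem _root_.measure_le_of_forall_dominatedUpTo (h : ∀ δ : ℝ≥0∞, δ ≠ 0 → DominatedUpTo δ μ ν) :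
    μ ≤ ν :=
  Measure.le_iff.2 fun _ hA => ENNReal.le_of_forall_pos_le_add fun δ hδ _ =>
    (h δ (by simpa using hδ.ne')).measure_le hA

/-- For probability measures the relation is symmetric: replace `f` by `1 - f`. -/
theorem symm [IsProbabilityMeasure μ] [IsProbabilityMeasure ν] (h : DominatedUpTo δ μ ν) :
    DominatedUpTo δ ν μ := fun f hf h1 => by
  have key : ∀ (m : Measure E) [IsProbabilityMeasure m],
      ∫⁻ x, (1 - f x) ∂m + ∫⁻ x, f x ∂m = 1 := fun m _ => by
    rw [← lintegral_add_right _ hf]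
    simp [tsub_add_cancel_of_le (h1 _)]
  have hfin : ∫⁻ x, (1 - f x) ∂ν ≠ ∞ := fun hh => by
    have := key ν
    simp [hh] at this
  have h2 := h (fun x => 1 - f x) (measurable_const.sub hf) (fun x => tsub_le_self)
  refine (ENNReal.add_le_add_iff_left hfin).1 ?_
  calc ∫⁻ x, (1 - f x) ∂ν + ∫⁻ x, f x ∂ν = ∫⁻ x, (1 - f x) ∂μ + ∫⁻ x, f x ∂μ := by
        rw [key ν, key μ]
    _ ≤ (∫⁻ x, (1 - f x) ∂ν + δ) + ∫⁻ x, f x ∂μ := by gcongr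
    _ = _ := by ring

/-- Markov kernels are contractions for the total variation distance. -/
theorem bind (h : DominatedUpTo δ μ ν) (κ : Kernel E E) [IsMarkovKernel κ] :
    DominatedUpTo δ (μ.bind κ) (ν.bind κ) := fun f hf h1 => by
  rw [Measure.lintegral_bind κ.aemeasurable hf.aemeasurable,
    Measure.lintegral_bind κ.aemeasurable hf.aemeasurable]
  refine h _ hf.lintegral_kernel fun x => ?_
  calc ∫⁻ y, f y ∂κ x ≤ ∫⁻ _, 1 ∂κ x := lintegral_mono h1
    _ = 1 := by simp

theorem add (h : DominatedUpTo δ μ ν) (h' : DominatedUpTo δ' μ' ν') :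
    DominatedUpTo (δ + δ') (μ + μ') (ν + ν') := fun f hf h1 => by
  simp only [lintegral_add_measure]
  calc _ ≤ (∫⁻ x, f x ∂ν + δ) + (∫⁻ x, f x ∂ν' + δ') := add_le_add (h f hf h1) (h' f hf h1)
    _ = _ := by ring

theorem smul (h : DominatedUpTo δ μ ν) (c : ℝ≥0∞) : DominatedUpTo (c * δ) (c • μ) (c • ν) :=
  fun f hf h1 => by
    simp only [lintegral_smul_measure, smul_eq_mul, ← mul_add]
    gcongr
    exact h f hf h1

end DominatedUpTo

section TotalVariation

variable {E : Type*} [MeasurableSpace E]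

/-- The supremum that defines the total variation distance controls all test functions with
values in `[0, 1]`, since each of them can be rescaled to have supremum `1`. -/
theorem dominatedUpTo_of_iSup_le {δ : ℝ≥0∞} {μ ν : Measure E} [IsProbabilityMeasure μ]
    [IsProbabilityMeasure ν]
    (h : ⨆ f ∈ unitBorelFunctions E, ENNReal.ofReal |(∫ x, f x ∂μ) - ∫ x, f x ∂ν| ≤ δ) :
    DominatedUpTo δ μ ν := fun f hf h1 => by
  set M : ℝ≥0∞ := ⨆ x, f x with hM
  have hM1 : M ≤ 1 := iSup_le h1
  have hMtop : M ≠ ∞ := ne_top_of_le_ne_top ENNReal.one_ne_top hM1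
  have hle : ∀ x, f x ≤ M := fun x => le_iSup f x
  rcases eq_or_ne M 0 with h0 | h0
  · have : ∀ x, f x = 0 := fun x => le_antisymm (h0 ▸ hle x) (zero_le)
    simp [this]
  set g : E → ℝ := fun x => (f x / M).toReal with hg
  have hgm : Measurable g := (hf.div_const M).ennreal_toReal
  have hfin : ∀ x, f x / M ≠ ∞ := fun x =>
    ENNReal.div_ne_top (ne_top_of_le_ne_top hMtop (hle x)) h0
  have hg1 : ∀ x, f x / M ≤ 1 := fun x => ENNReal.div_le_of_le_mul (by simpa using hle x)
  have hgu : g ∈ unitBorelFunctions E := by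
    refine ⟨hgm, ?_⟩
    have : ∀ x, ‖g x‖ₑ = f x / M := fun x => by
      rw [Real.enorm_of_nonneg ENNReal.toReal_nonneg, ENNReal.ofReal_toReal (hfin x)]
    simp only [this, div_eq_mul_inv]
    rw [← ENNReal.iSup_mul, ← hM, ENNReal.mul_inv_cancel h0 hMtop]
  have hint : ∀ m : Measure E, [IsProbabilityMeasure m] →
      ∫⁻ x, f x ∂m = M * ENNReal.ofReal (∫ x, g x ∂m) := fun m _ => by
    rw [integral_toReal (hf.div_const M).aemeasurable
      (ae_of_all _ fun x => (hfin x).lt_top), ENNReal.ofReal_toReal]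
    · rw [← lintegral_const_mul _ (hf.div_const M)]
      congr with x
      exact (ENNReal.mul_div_cancel h0 hMtop).symm
    · refine ne_top_of_le_ne_top ENNReal.one_ne_top ?_
      calc _ ≤ ∫⁻ _, 1 ∂m := lintegral_mono hg1
        _ = 1 := by simp
  have hgδ := (le_iSup₂ (f := fun f (_ : f ∈ unitBorelFunctions E) =>
    ENNReal.ofReal |(∫ x, f x ∂μ) - ∫ x, f x ∂ν|) g hgu).trans h
  rw [hint μ, hint ν]
  have h3 : ENNReal.ofReal (∫ x, g x ∂μ) ≤ ENNReal.ofReal (∫ x, g x ∂ν) + δ := by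
    calc _ ≤ ENNReal.ofReal ((∫ x, g x ∂ν) + |(∫ x, g x ∂μ) - ∫ x, g x ∂ν|) := by
          apply ENNReal.ofReal_le_ofReal
          linarith [le_abs_self ((∫ x, g x ∂μ) - ∫ x, g x ∂ν)]
      _ ≤ _ := ENNReal.ofReal_add_le
      _ ≤ _ := by gcongr
  calc _ ≤ M * (ENNReal.ofReal (∫ x, g x ∂ν) + δ) := by gcongr
    _ = M * ENNReal.ofReal (∫ x, g x ∂ν) + M * δ := by ring
    _ ≤ _ := by gcongr; exact mul_le_of_le_one_left (zero_le) hM1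

theorem abs_le_one_of_mem_unitBorelFunctions {f : E → ℝ} (hf : f ∈ unitBorelFunctions E) (x : E) :
    |f x| ≤ 1 := by
  have : ‖f x‖ₑ ≤ 1 := hf.2 ▸ le_iSup (fun x => ‖f x‖ₑ) x
  rw [← ofReal_norm, ENNReal.ofReal_le_one] at this
  simpa using this

theorem DominatedUpTo.integral_le {δ : ℝ≥0} {μ ν : Measure E} [IsProbabilityMeasure μ]
    [IsProbabilityMeasure ν] (h : DominatedUpTo δ μ ν) {f : E → ℝ} (hf : Measurable f)
    (h1 : ∀ x, |f x| ≤ 1) : ∫ x, f x ∂μ ≤ ∫ x, f x ∂ν + 2 * δ := by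
  -- The test function `(1 + f) / 2` takes values in `[0, 1]`.
  have hint : ∀ m : Measure E, [IsProbabilityMeasure m] →
      ∫⁻ x, ENNReal.ofReal ((1 + f x) / 2) ∂m = ENNReal.ofReal ((1 + ∫ x, f x ∂m) / 2) ∧
      -1 ≤ ∫ x, f x ∂m := fun m _ => by
    have hi : Integrable f m := Integrable.of_bound hf.aestronglyMeasurable 1
      (ae_of_all _ fun x => by simpa using h1 x)
    constructor
    · rw [← ofReal_integral_eq_lintegral_ofReal]
      · rw [integral_div, integral_add (integrable_const _) hi]
        simp
      · exact ((integrable_const _).add hi).div_const 2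
      · exact ae_of_all _ fun x => by
          have := abs_le.1 (h1 x)
          simp only [Pi.zero_apply]; linarith
    · have := integral_mono (μ := m) (integrable_const (-1)) hi fun x => (abs_le.1 (h1 x)).1
      simpa using this
  have h2 := h (fun x => ENNReal.ofReal ((1 + f x) / 2)) (by fun_prop) fun x => by
    rw [ENNReal.ofReal_le_one]
    linarith [(abs_le.1 (h1 x)).2]
  have hμ := hint μ
  have hν := hint ν
  rw [hμ.1, hν.1, ← ENNReal.ofReal_coe_nnreal,
    ← ENNReal.ofReal_add (by linarith [hν.2]) δ.coe_nonneg,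
    ENNReal.ofReal_le_ofReal_iff (by have := δ.coe_nonneg; linarith [hν.2])] at h2
  linarith

theorem DominatedUpTo.iSup_le {δ : ℝ≥0∞} {μ ν : Measure E} [IsProbabilityMeasure μ]
    [IsProbabilityMeasure ν] (h : DominatedUpTo δ μ ν) :
    ⨆ f ∈ unitBorelFunctions E, ENNReal.ofReal |(∫ x, f x ∂μ) - ∫ x, f x ∂ν| ≤ 2 * δ := by
  induction δ with
  | top => simp
  | coe δ =>
  refine iSup₂_le fun f hf => ?_
  have h1 := abs_le_one_of_mem_unitBorelFunctions hf
  have : |(∫ x, f x ∂μ) - ∫ x, f x ∂ν| ≤ 2 * δ := by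
    rw [abs_le]
    constructor <;> linarith [h.integral_le hf.1 h1, h.symm.integral_le hf.1 h1]
  calc _ ≤ ENNReal.ofReal (2 * δ) := ENNReal.ofReal_le_ofReal this
    _ = 2 * δ := by rw [ENNReal.ofReal_mul (by norm_num)]; simp

theorem DominatedUpTo.tvDist_le {δ : ℝ≥0∞} {μ ν : ProbabilityMeasure E}
    (h : DominatedUpTo δ (μ : Measure E) (ν : Measure E)) : tvDist μ ν ≤ δ := by
  unfold tvDist
  calc _ ≤ 2⁻¹ * (2 * δ) := by gcongr; exact h.iSup_le
    _ = δ := by rw [← mul_assoc, ENNReal.inv_mul_cancel] <;> simp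

theorem dominatedUpTo_two_mul_tvDist (μ ν : ProbabilityMeasure E) :
    DominatedUpTo (2 * tvDist μ ν) (μ : Measure E) (ν : Measure E) := by
  apply dominatedUpTo_of_iSup_le
  unfold tvDist
  rw [← mul_assoc, ENNReal.mul_inv_cancel] <;> simp

end TotalVariation

/-! ### Merging of laws -/

section Mixtures

variable {E : Type*} [MeasurableSpace E]

/-- A probability measure giving mass at least `θ` to `B` is a mixture, with weights `θ` and
`1 - θ`, of a probability measure carried by `B` and another one. -/
theorem exists_eq_smul_add_smul {B : Set E} (hBm : MeasurableSet B) {θ : ℝ≥0∞} (hθ0 : θ ≠ 0)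
    (hθ1 : θ < 1) (ν : Measure E) [IsProbabilityMeasure ν] (hν : θ ≤ ν B) :
    ∃ κ κ' : Measure E, IsProbabilityMeasure κ ∧ IsProbabilityMeasure κ' ∧ κ Bᶜ = 0 ∧
      ν = θ • κ + (1 - θ) • κ' := by
  have hB0 : ν B ≠ 0 := fun h => hθ0 (le_antisymm (h ▸ hν) zero_le)
  have hBt : ν B ≠ ∞ := measure_ne_top _ _
  have h10 : 1 - θ ≠ 0 := (tsub_pos_of_lt hθ1).ne'
  have h1t : 1 - θ ≠ ∞ := ne_top_of_le_ne_top ENNReal.one_ne_top tsub_le_self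
  have hκ : ((ν B)⁻¹ • ν.restrict B) Set.univ = 1 := by
    simp [ENNReal.inv_mul_cancel hB0 hBt]
  have hsplit : ν = θ • ((ν B)⁻¹ • ν.restrict B) + (1 - θ) •
      ((1 - θ)⁻¹ • (ν.restrict Bᶜ + (1 - θ / ν B) • ν.restrict B)) := by
    rw [smul_smul, smul_smul, ENNReal.mul_inv_cancel h10 h1t, one_smul, ← div_eq_mul_inv,
      add_comm (ν.restrict Bᶜ), ← add_assoc, ← add_smul, add_tsub_cancel_of_le, one_smul,
      Measure.restrict_add_restrict_compl hBm]
    exact ENNReal.div_le_of_le_mul (by simpa using hν)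
  have hmass : ∀ κ κ' : Measure E, κ Set.univ = 1 → ν = θ • κ + (1 - θ) • κ' →
      κ' Set.univ = 1 := fun κ κ' h1 h => by
    have h2 : θ + (1 - θ) * 1 = θ + (1 - θ) * κ' Set.univ := by
      rw [mul_one, add_tsub_cancel_of_le hθ1.le]
      simpa [h1] using congrArg (fun m : Measure E => m Set.univ) h
    exact ((ENNReal.mul_right_inj h10 h1t).1 ((ENNReal.add_right_inj hθ1.ne_top).1 h2)).symm
  refine ⟨_, _, ⟨hκ⟩, ⟨?_⟩, ?_, hsplit⟩
  · exact hmass _ _ hκ hsplit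
  · simp [Measure.restrict_apply hBm.compl]

theorem DominatedUpTo.of_eq_smul_add_smul {θ δ δ' : ℝ≥0∞} {κ₁ κ₂ κ₁' κ₂' : Measure E}
    (Q : Kernel E E)
    (h : DominatedUpTo δ (κ₁.bind Q) (κ₂.bind Q)) (h' : DominatedUpTo δ' (κ₁'.bind Q) (κ₂'.bind Q)) :
    DominatedUpTo (θ * δ + (1 - θ) * δ') ((θ • κ₁ + (1 - θ) • κ₁').bind Q)
      ((θ • κ₂ + (1 - θ) • κ₂').bind Q) := by
  have key : ∀ κ κ' : Measure E, (θ • κ + (1 - θ) • κ').bind Q =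
      θ • κ.bind Q + (1 - θ) • κ'.bind Q := fun κ κ' => by
    ext A hA
    simp only [Measure.add_apply, Measure.smul_apply,
      Measure.bind_apply hA Q.aemeasurable, lintegral_add_measure, lintegral_smul_measure]
  rw [key, key]
  exact (h.smul θ).add (h'.smul (1 - θ))

end Mixtures

namespace MarkovFellerSemigroup

variable {E : Type*} [TopologicalSpace E] [MeasurableSpace E] (P : MarkovFellerSemigroup E)

theorem bind_kernel_add (ν : Measure E) (s t : ℝ≥0) :
    ν.bind (P.kernel (s + t)) = (ν.bind (P.kernel s)).bind (P.kernel t) := by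
  rw [Measure.bind_bind (P.kernel s).aemeasurable (P.kernel t).aemeasurable, P.kernel_add]
  congr 1

theorem kernel_add_apply (s t : ℝ≥0) (x : E) :
    P.kernel (s + t) x = (P.kernel s x).bind (P.kernel t) := by
  rw [P.kernel_add, Kernel.comp_apply]

theorem _root_.DominatedUpTo.bind_kernel_of_le {δ : ℝ≥0∞} {ν₁ ν₂ : Measure E} {s t : ℝ≥0}
    (h : DominatedUpTo δ (ν₁.bind (P.kernel s)) (ν₂.bind (P.kernel s))) (hst : s ≤ t) :
    DominatedUpTo δ (ν₁.bind (P.kernel t)) (ν₂.bind (P.kernel t)) := by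
  rw [← add_tsub_cancel_of_le hst, bind_kernel_add, bind_kernel_add]
  exact h.bind _

theorem _root_.DominatedUpTo.kernel_of_le {δ : ℝ≥0∞} {x y : E} {s t : ℝ≥0}
    (h : DominatedUpTo δ (P.kernel s x) (P.kernel s y)) (hst : s ≤ t) :
    DominatedUpTo δ (P.kernel t x) (P.kernel t y) := by
  rw [← add_tsub_cancel_of_le hst, kernel_add_apply, kernel_add_apply]
  exact h.bind _

/-- If the laws started from the points of `B` all merge with the law started from `z` up to `η`,
at times depending on the point, then the law started from any distribution carried by `B` merges
with it up to `2 * η`. -/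
theorem exists_dominatedUpTo_of_measure_compl_eq_zero {z : E} {B : Set E} {η : ℝ≥0∞} (hη : η ≠ 0)
    (hB : ∀ x ∈ B, ∃ n : ℕ, DominatedUpTo η (P.kernel n x) (P.kernel n z))
    (κ : Measure E) [IsProbabilityMeasure κ] (hκ : κ Bᶜ = 0) :
    ∃ n : ℕ, DominatedUpTo (2 * η) (κ.bind (P.kernel n)) (P.kernel n z) := by
  rcases le_or_gt 1 η with h1 | h1
  · refine ⟨0, DominatedUpTo.of_isProbabilityMeasure.mono (h1.trans ?_)⟩
    rw [two_mul]; exact le_self_add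
  -- These sets need not be measurable, but continuity from below holds for outer measures.
  set A : ℕ → Set E := fun n => {x | DominatedUpTo η (P.kernel n x) (P.kernel n z)} with hA
  have hmono : Monotone A := fun m n hmn x hx =>
    DominatedUpTo.kernel_of_le P hx (by exact_mod_cast hmn)
  have hun : κ (⋃ n, A n) = 1 := by
    apply le_antisymm prob_le_one
    have hBA : B ⊆ ⋃ n, A n := fun x hx => Set.mem_iUnion.2 (hB x hx)
    calc (1 : ℝ≥0∞) = κ (B ∪ Bᶜ) := by simp
      _ ≤ κ B + κ Bᶜ := measure_union_le _ _
      _ ≤ _ := by rw [hκ, add_zero]; exact measure_mono hBA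
  have hlt : 1 - η < κ (⋃ n, A n) := by
    rw [hun]; exact ENNReal.sub_lt_self ENNReal.one_ne_top one_ne_zero hη
  rw [hmono.measure_iUnion, lt_iSup_iff] at hlt
  obtain ⟨n, hn⟩ := hlt
  refine ⟨n, fun f hf hf1 => ?_⟩
  rw [Measure.lintegral_bind (P.kernel n).aemeasurable hf.aemeasurable]
  set b := ∫⁻ y, f y ∂P.kernel n z
  set g : E → ℝ≥0∞ := fun x => ∫⁻ y, f y ∂P.kernel n x with hg
  have hgm : Measurable g := hf.lintegral_kernel
  have hg1 : ∀ x, g x ≤ 1 := fun x => by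
    calc g x ≤ ∫⁻ _, 1 ∂P.kernel n x := lintegral_mono hf1
      _ = 1 := by simp
  set C : Set E := {x | g x ≤ b + η} with hC
  have hCm : MeasurableSet C := measurableSet_le hgm measurable_const
  have hAC : A n ⊆ C := fun x hx => hx f hf hf1
  have hCc : κ Cᶜ ≤ η := by
    rw [prob_compl_eq_one_sub hCm, tsub_le_iff_left, ← tsub_le_iff_right]
    exact hn.le.trans (measure_mono hAC)
  calc ∫⁻ x, g x ∂κ = ∫⁻ x in C, g x ∂κ + ∫⁻ x in Cᶜ, g x ∂κ :=
        (lintegral_add_compl _ hCm).symm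
    _ ≤ ∫⁻ _ in C, (b + η) ∂κ + ∫⁻ _ in Cᶜ, 1 ∂κ :=
        add_le_add (setLIntegral_mono measurable_const fun x hx => hx)
          (setLIntegral_mono measurable_const fun x _ => hg1 x)
    _ ≤ (b + η) * 1 + η := by
        rw [setLIntegral_const, setLIntegral_one]
        gcongr
        exact prob_le_one
    _ = b + 2 * η := by ring

/-- By Fatou's lemma, a lower bound on the visits to `B` from all points is inherited by all
initial distributions. -/
theorem eventually_le_bind_kernel {B : Set E} (hBm : MeasurableSet B) {θ : ℝ≥0∞}
    (hθ : ∀ x, θ ≤ liminf (fun n : ℕ => P.kernel n x B) atTop) {θ' : ℝ≥0∞} (hθ' : θ' < θ)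
    (ν : Measure E) [IsProbabilityMeasure ν] :
    ∀ᶠ n : ℕ in atTop, θ' ≤ ν.bind (P.kernel n) B := by
  have : θ' < liminf (fun n : ℕ => ν.bind (P.kernel n) B) atTop := by
    simp_rw [Measure.bind_apply hBm (P.kernel _).aemeasurable]
    calc θ' < θ := hθ'
      _ = ∫⁻ _, θ ∂ν := by simp
      _ ≤ ∫⁻ x, liminf (fun n : ℕ => P.kernel n x B) atTop ∂ν := lintegral_mono hθ
      _ ≤ _ := lintegral_liminf_le fun n => (P.kernel n).measurable_coe hBm
  exact (eventually_lt_of_lt_liminf this).mono fun _ h => h.le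

/-- The improvement step for merging: any two laws eventually each place the mass `θ` on `B`, those
parts merge up to `4 * η`, and the remaining parts merge up to `r`. -/
theorem exists_dominatedUpTo_step {z : E} {B : Set E} (hBm : MeasurableSet B) {η : ℝ≥0∞}
    (hη : η ≠ 0) (hB : ∀ x ∈ B, ∃ n : ℕ, DominatedUpTo η (P.kernel n x) (P.kernel n z))
    {θ : ℝ≥0∞} (hθ0 : θ ≠ 0) (hθ1 : θ < 1)
    (hθ : ∀ (ν : Measure E) [IsProbabilityMeasure ν],
      ∀ᶠ n : ℕ in atTop, θ ≤ ν.bind (P.kernel n) B) {r : ℝ≥0∞}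
    (hr : ∀ (ν₁ ν₂ : Measure E) [IsProbabilityMeasure ν₁] [IsProbabilityMeasure ν₂],
      ∃ n : ℕ, DominatedUpTo r (ν₁.bind (P.kernel n)) (ν₂.bind (P.kernel n)))
    (ν₁ ν₂ : Measure E) [IsProbabilityMeasure ν₁] [IsProbabilityMeasure ν₂] :
    ∃ n : ℕ, DominatedUpTo (θ * (4 * η) + (1 - θ) * r)
      (ν₁.bind (P.kernel n)) (ν₂.bind (P.kernel n)) := by
  obtain ⟨m, hm₁, hm₂⟩ := ((hθ ν₁).and (hθ ν₂)).exists
  obtain ⟨κ₁, κ₁', _, _, hκ₁, e₁⟩ := exists_eq_smul_add_smul hBm hθ0 hθ1 _ hm₁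
  obtain ⟨κ₂, κ₂', _, _, hκ₂, e₂⟩ := exists_eq_smul_add_smul hBm hθ0 hθ1 _ hm₂
  obtain ⟨n₁, h₁⟩ := P.exists_dominatedUpTo_of_measure_compl_eq_zero hη hB κ₁ hκ₁
  obtain ⟨n₂, h₂⟩ := P.exists_dominatedUpTo_of_measure_compl_eq_zero hη hB κ₂ hκ₂
  obtain ⟨n₃, h₃⟩ := hr κ₁' κ₂'
  set N := max (max n₁ n₂) n₃ with hN
  have hz : ∀ n : ℕ, P.kernel n z = (Measure.dirac z).bind (P.kernel n) := fun n =>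
    (Measure.dirac_bind (P.kernel n).measurable z).symm
  rw [hz] at h₁ h₂
  have h₁' := h₁.bind_kernel_of_le P (t := N) (by exact_mod_cast (by omega))
  have h₂' := h₂.bind_kernel_of_le P (t := N) (by exact_mod_cast (by omega))
  have h₃' := h₃.bind_kernel_of_le P (t := N) (by exact_mod_cast (by omega))
  refine ⟨m + N, ?_⟩
  rw [Nat.cast_add, bind_kernel_add, bind_kernel_add, e₁, e₂]
  refine DominatedUpTo.of_eq_smul_add_smul _ ((h₁'.trans h₂'.symm).mono ?_) h₃'
  rw [← add_mul]; norm_num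

/-- Iterating the improvement step, all laws merge in total variation. -/
theorem exists_dominatedUpTo_of_step {z : E} {B : Set E} (hBm : MeasurableSet B) {η : ℝ≥0∞}
    (hη : η ≠ 0) (hB : ∀ x ∈ B, ∃ n : ℕ, DominatedUpTo η (P.kernel n x) (P.kernel n z))
    {θ : ℝ≥0∞} (hθ0 : θ ≠ 0) (hθ1 : θ < 1)
    (hθ : ∀ (ν : Measure E) [IsProbabilityMeasure ν],
      ∀ᶠ n : ℕ in atTop, θ ≤ ν.bind (P.kernel n) B)
    (ν₁ ν₂ : Measure E) [IsProbabilityMeasure ν₁] [IsProbabilityMeasure ν₂] :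
    ∃ n : ℕ, DominatedUpTo (5 * η) (ν₁.bind (P.kernel n)) (ν₂.bind (P.kernel n)) := by
  have main : ∀ k : ℕ, ∀ (ν₁ ν₂ : Measure E) [IsProbabilityMeasure ν₁] [IsProbabilityMeasure ν₂],
      ∃ n : ℕ, DominatedUpTo (4 * η + (1 - θ) ^ k)
        (ν₁.bind (P.kernel n)) (ν₂.bind (P.kernel n)) := by
    intro k
    induction k with
    | zero => exact fun ν₁ ν₂ _ _ => ⟨0, DominatedUpTo.of_isProbabilityMeasure.mono (by simp)⟩
    | succ k ih =>
      intro ν₁ ν₂ _ _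
      obtain ⟨n, hn⟩ := P.exists_dominatedUpTo_step hBm hη hB hθ0 hθ1 hθ ih ν₁ ν₂
      refine ⟨n, hn.mono (le_of_eq ?_)⟩
      calc θ * (4 * η) + (1 - θ) * (4 * η + (1 - θ) ^ k)
          = (θ + (1 - θ)) * (4 * η) + (1 - θ) ^ (k + 1) := by ring
        _ = _ := by rw [add_tsub_cancel_of_le hθ1.le, one_mul]
  have hlim := ENNReal.tendsto_pow_atTop_nhds_zero_of_lt_one
    (ENNReal.sub_lt_self ENNReal.one_ne_top one_ne_zero hθ0)
  obtain ⟨k, hk⟩ := (hlim.eventually (ge_mem_nhds (pos_iff_ne_zero.2 hη))).exists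
  obtain ⟨n, hn⟩ := main k ν₁ ν₂
  refine ⟨n, hn.mono ?_⟩
  calc 4 * η + (1 - θ) ^ k ≤ 4 * η + η := by gcongr
    _ = 5 * η := by ring

end MarkovFellerSemigroup

/-! ### Setwise limits of measures and invariant measures -/

section MeasureLimits

variable {E : Type*} [MeasurableSpace E]

/-- The setwise supremum of an increasing sequence of measures is a measure. -/
theorem exists_measure_eq_iSup (c : ℕ → Measure E) (hc : Monotone c) :
    ∃ m : Measure E, ∀ A, MeasurableSet A → m A = ⨆ k, c k A := by
  refine ⟨Measure.ofMeasurable (fun A _ => ⨆ k, c k A) (by simp) ?_, fun A hA =>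
    Measure.ofMeasurable_apply A hA⟩
  intro A hA hd
  simp only [measure_iUnion hd hA, ENNReal.tsum_eq_iSup_sum]
  rw [iSup_comm]
  congr with s
  exact (ENNReal.finsetSum_iSup_of_monotone (f := fun i k => c k (A i))
    fun i k l hkl => hc hkl (A i)).symm

/-- Sequences of measures dominated by a fixed finite measure converge setwise along every
ultrafilter: the limit is additive, and the domination makes it countably additive. -/
theorem exists_measure_tendsto_ultrafilter {ι : Type*} (U : Ultrafilter ι) (a : ι → Measure E)
    (ρ : Measure E) [IsFiniteMeasure ρ] (ha : ∀ n, a n ≤ ρ) :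
    ∃ m : Measure E, ∀ A, MeasurableSet A → Tendsto (fun n => a n A) U (𝓝 (m A)) := by
  have hlim : ∀ A : Set E, ∃ l : ℝ≥0∞, Tendsto (fun n => a n A) U (𝓝 l) := fun A =>
    ⟨_, (U.map fun n => a n A).le_nhds_lim⟩
  choose c hc using hlim
  have hcρ : ∀ A, c A ≤ ρ A := fun A => le_of_tendsto' (hc A) fun n => ha n A
  have hadd : ∀ A B, Disjoint A B → MeasurableSet B → c (A ∪ B) = c A + c B :=
    fun A B hd hB => by
      refine tendsto_nhds_unique (hc (A ∪ B)) ?_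
      simp only [measure_union hd hB]
      exact (hc A).add (hc B)
  refine ⟨Measure.ofMeasurable (fun A _ => c A) ?_ ?_, fun A hA => ?_⟩
  · exact le_antisymm (by simpa using hcρ ∅) zero_le
  · intro A hA hd
    set R : ℕ → Set E := fun n => ⋃ i, A (i + n) with hR
    have hstep : ∀ n, c (R n) = c (A n) + c (R (n + 1)) := fun n => by
      have hun : R n = A n ∪ R (n + 1) := by
        ext x
        simp only [hR, Set.mem_iUnion, Set.mem_union]
        constructor
        · rintro ⟨i, hi⟩
          cases i with
          | zero => left; simpa using hi
          | succ i => right; exact ⟨i, by convert hi using 2; omega⟩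
        · rintro (h | ⟨i, hi⟩)
          · exact ⟨0, by simpa using h⟩
          · exact ⟨i + 1, by convert hi using 2; omega⟩
      rw [hun, hadd _ _ _ (MeasurableSet.iUnion fun i => hA _)]
      exact Set.disjoint_iUnion_right.2 fun i => hd (by omega)
    have hsum : ∀ n, c (⋃ i, A i) = ∑ i ∈ Finset.range n, c (A i) + c (R n) := fun n => by
      induction n with
      | zero => simp [hR]
      | succ n ih => rw [ih, hstep, Finset.sum_range_succ, add_assoc]
    have hRlim : Tendsto (fun n => c (R n)) atTop (𝓝 0) := by
      have hfin : ∑' i, ρ (A i) ≠ ∞ := by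
        rw [← measure_iUnion hd hA]; exact measure_ne_top _ _
      exact tendsto_of_tendsto_of_tendsto_of_le_of_le tendsto_const_nhds
        (ENNReal.tendsto_sum_nat_add _ hfin) (fun _ => zero_le)
        fun n => (hcρ _).trans (measure_iUnion_le _)
    have hlim := (ENNReal.tendsto_nat_tsum fun i => c (A i)).add hRlim
    simp only [← hsum, add_zero] at hlim
    exact tendsto_nhds_unique tendsto_const_nhds hlim
  · rw [Measure.ofMeasurable_apply A hA]
    exact hc A

/-- Integrals of nonnegative functions are lower semicontinuous under setwise convergence. -/
theorem lintegral_le_of_tendsto_setwise {ι : Type*} {l : Filter ι} [l.NeBot] {a : ι → Measure E}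
    {m : Measure E} (ha : ∀ A, MeasurableSet A → Tendsto (fun n => a n A) l (𝓝 (m A)))
    {f : E → ℝ≥0∞} {b : ι → ℝ≥0∞} {b' : ℝ≥0∞} (hb : Tendsto b l (𝓝 b'))
    (hab : ∀ᶠ n in l, ∫⁻ x, f x ∂a n ≤ b n) : ∫⁻ x, f x ∂m ≤ b' := by
  rw [lintegral_eq_nnreal]
  refine iSup₂_le fun φ hφ => ?_
  refine le_of_tendsto_of_tendsto (f := fun n => (φ.map ((↑) : ℝ≥0 → ℝ≥0∞)).lintegral (a n))
    ?_ hb (hab.mono fun n hn => ?_)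
  · simp only [SimpleFunc.map_lintegral]
    exact tendsto_finsetSum _ fun x _ => ENNReal.Tendsto.const_mul
      (ha _ (φ.measurableSet_fiber x)) (Or.inr ENNReal.coe_ne_top)
  · beta_reduce
    rw [← SimpleFunc.lintegral_eq_lintegral]
    exact (lintegral_mono hφ).trans hn

theorem DominatedUpTo.inf_measure_le {δ : ℝ≥0∞} {μ ν : Measure E} (h : DominatedUpTo δ μ ν)
    (ρ : Measure E) {A : Set E} (hA : MeasurableSet A) : (μ ⊓ ρ) A ≤ (ν ⊓ ρ) A + δ := by
  have hle : ∀ t, μ t ≤ ν t + δ := fun t => by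
    calc μ t ≤ μ (toMeasurable ν t) := measure_mono (subset_toMeasurable ν t)
      _ ≤ ν (toMeasurable ν t) + δ := h.measure_le (measurableSet_toMeasurable ν t)
      _ = ν t + δ := by rw [measure_toMeasurable]
  rw [Measure.inf_apply hA, Measure.inf_apply hA, ← tsub_le_iff_right]
  refine le_sInf ?_
  rintro _ ⟨t, rfl⟩
  rw [tsub_le_iff_right]
  calc _ ≤ μ (t ∩ A) + ρ (tᶜ ∩ A) := by
        apply sInf_le; exact ⟨t, rfl⟩
    _ ≤ (ν (t ∩ A) + δ) + ρ (tᶜ ∩ A) := by gcongr; exact hle _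
    _ = _ := by ring

theorem bind_mono_left {μ ν : Measure E} (h : μ ≤ ν) (Q : Kernel E E) : μ.bind Q ≤ ν.bind Q :=
  Measure.le_iff.2 fun A hA => by
    rw [Measure.bind_apply hA Q.aemeasurable, Measure.bind_apply hA Q.aemeasurable]
    exact lintegral_mono' h le_rfl

theorem bind_smul_left (c : ℝ≥0∞) (μ : Measure E) (Q : Kernel E E) :
    (c • μ).bind Q = c • μ.bind Q := by
  ext A hA
  simp [Measure.bind_apply hA Q.aemeasurable]

/-- An asymptotically stationary trajectory `μ n` of a Markov kernel that keeps a nontrivial part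
below a fixed multiple of an almost excessive measure `π` gives rise to an invariant probability
measure: the increasing limit in `k` of the ultrafilter limits of `μ n ⊓ 2 ^ k • π`. -/
theorem exists_invariant_of_le_inf (Q : Kernel E E) [IsMarkovKernel Q] (μ : ℕ → Measure E)
    [∀ n, IsProbabilityMeasure (μ n)] (hμ : ∀ n, μ (n + 1) = (μ n).bind Q)
    (hreg : ∀ δ : ℝ≥0∞, δ ≠ 0 → ∀ᶠ n in atTop, DominatedUpTo δ (μ (n + 1)) (μ n))
    (π : Measure E) [IsFiniteMeasure π] (hπ : π.bind Q ≤ (2 : ℝ≥0∞) • π) (K : ℕ) {γ : ℝ≥0∞}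
    (hγ : γ ≠ 0) (h : ∀ᶠ n in atTop, γ ≤ (μ n ⊓ ((2 : ℝ≥0∞) ^ K • π)) Set.univ) :
    ∃ m : Measure E, IsProbabilityMeasure m ∧ m.bind Q = m := by
  set U : Ultrafilter ℕ := hyperfilter ℕ with hU
  have hUle : (U : Filter ℕ) ≤ atTop := Nat.hyperfilter_le_atTop
  have hfin : ∀ k : ℕ, IsFiniteMeasure ((2 : ℝ≥0∞) ^ k • π) := fun k =>
    ⟨by simpa using ENNReal.mul_lt_top (by finiteness) (measure_lt_top π _)⟩
  have hex : ∀ k : ℕ, ∃ m : Measure E, ∀ A, MeasurableSet A →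
      Tendsto (fun n => (μ n ⊓ ((2 : ℝ≥0∞) ^ k • π)) A) U (𝓝 (m A)) := fun k =>
    exists_measure_tendsto_ultrafilter U _ ((2 : ℝ≥0∞) ^ k • π) fun n => inf_le_right
  choose c hc using hex
  have hmono : Monotone c := monotone_nat_of_le_succ fun k => Measure.le_iff.2 fun A hA => by
    refine le_of_tendsto_of_tendsto' (hc k A hA) (hc (k + 1) A hA) fun n => ?_
    refine (inf_le_inf_left (μ n) (Measure.le_iff.2 fun B _ => ?_) : _ ≤ _) A
    simp only [Measure.smul_apply, smul_eq_mul]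
    gcongr
    · norm_num
    · omega
  have hbind : ∀ k, (c k).bind Q ≤ c (k + 1) := fun k => Measure.le_iff.2 fun A hA => by
    refine ENNReal.le_of_forall_pos_le_add fun δ hδ _ => ?_
    rw [Measure.bind_apply hA Q.aemeasurable]
    refine lintegral_le_of_tendsto_setwise (hc k)
      ((hc (k + 1) A hA).add_const _) (hUle ((hreg δ (by simpa using hδ.ne')).mono fun n hn => ?_))
    rw [← Measure.bind_apply hA Q.aemeasurable]
    refine le_trans (?_ : _ ≤ (μ (n + 1) ⊓ ((2 : ℝ≥0∞) ^ (k + 1) • π)) A) (hn.inf_measure_le _ hA)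
    refine (le_inf ?_ ?_ : (μ n ⊓ ((2 : ℝ≥0∞) ^ k • π)).bind Q ≤ _) A
    · rw [hμ]; exact bind_mono_left inf_le_left Q
    · refine (bind_mono_left inf_le_right Q).trans ?_
      rw [bind_smul_left, pow_succ, mul_smul]
      exact Measure.le_iff.2 fun B _ => by
        have := hπ B
        simp only [Measure.smul_apply, smul_eq_mul] at this ⊢
        gcongr
  obtain ⟨C, hC⟩ := exists_measure_eq_iSup c hmono
  have hCk : ∀ k A, MeasurableSet A → c k A ≤ C A := fun k A hA => by
    rw [hC A hA]; exact le_iSup (fun k => c k A) k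
  have hC1 : C Set.univ ≤ 1 := by
    rw [hC _ .univ]
    refine iSup_le fun k => le_of_tendsto' (hc k _ .univ) fun n => ?_
    calc _ ≤ μ n Set.univ := (inf_le_left : μ n ⊓ _ ≤ μ n) _
      _ = 1 := measure_univ
  have hC0 : C Set.univ ≠ 0 := by
    refine (lt_of_lt_of_le (pos_iff_ne_zero.2 hγ) (le_trans ?_ (hCk K _ .univ))).ne'
    exact ge_of_tendsto (hc K _ .univ) (hUle h)
  have hCt : C Set.univ ≠ ∞ := ne_top_of_le_ne_top ENNReal.one_ne_top hC1
  have : IsFiniteMeasure C := ⟨hCt.lt_top⟩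
  have hCQ : C.bind Q ≤ C := Measure.le_iff.2 fun A hA => by
    rw [Measure.bind_apply hA Q.aemeasurable]
    refine lintegral_le_of_tendsto_setwise (l := atTop) (a := c) (b := fun _ => C A)
      (fun B hB => ?_) tendsto_const_nhds (Eventually.of_forall fun k => ?_)
    · rw [hC B hB]
      exact tendsto_atTop_iSup fun k l hkl => hmono hkl B
    · rw [← Measure.bind_apply hA Q.aemeasurable]
      exact (hbind k A).trans (hCk _ A hA)
  -- A Markov kernel preserves the total mass, so the inequality is an equality.
  have hCeq : C.bind Q = C := by
    refine Measure.eq_of_le_of_measure_univ_eq hCQ ?_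
    rw [Measure.bind_apply .univ Q.aemeasurable]
    simp
  refine ⟨(C Set.univ)⁻¹ • C, ⟨?_⟩, ?_⟩
  · simp [ENNReal.inv_mul_cancel hC0 hCt]
  · rw [bind_smul_left, hCeq]

end MeasureLimits

/-! ### The Feller property, recurrence and the occupation measure -/

namespace MarkovFellerSemigroup

variable {E : Type*}

theorem continuous_lintegral_kernel [TopologicalSpace E] [MeasurableSpace E]
    [OpensMeasurableSpace E] (P : MarkovFellerSemigroup E) (t : ℝ≥0) (f : E →ᵇ ℝ≥0)
    (hf : ∀ x, f x ≤ 1) : Continuous fun x => ∫⁻ y, f y ∂P.kernel t x := by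
  set g : E →ᵇ ℝ := BoundedContinuousFunction.ofNormedAddCommGroup (fun y => (f y : ℝ))
    (NNReal.continuous_coe.comp f.continuous) 1 (fun x => by simpa using hf x) with hg
  have hfg : (fun x => ∫⁻ y, f y ∂P.kernel t x) =
      fun x => ENNReal.ofReal (∫ y, g y ∂P.kernel t x) := by
    ext x
    rw [ofReal_integral_eq_lintegral_ofReal (g.integrable _) (ae_of_all _ fun y => (f y).2)]
    simp [hg]
  rw [hfg]
  exact ENNReal.continuous_ofReal.comp (P.feller t g)

section Occupation

variable [TopologicalSpace E] [MeasurableSpace E] (P : MarkovFellerSemigroup E)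

/-- The law of the trajectory from `z` at an independent time `n` with weight `2 ^ (-(n + 1))`. -/
noncomputable def occupation (z : E) : Measure E :=
  Measure.sum fun n : ℕ => ((2 : ℝ≥0∞)⁻¹ ^ (n + 1)) • P.kernel n z

instance (z : E) : IsProbabilityMeasure (P.occupation z) :=
  ⟨by simp [occupation, ENNReal.tsum_geometric_add_one, ENNReal.one_sub_inv_two,
    ENNReal.inv_mul_cancel]⟩

theorem kernel_le_occupation (z : E) (n : ℕ) :
    P.kernel n z ≤ (2 : ℝ≥0∞) ^ (n + 1) • P.occupation z := Measure.le_iff.2 fun A hA => by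
  rw [Measure.smul_apply, occupation, Measure.sum_apply _ hA, smul_eq_mul]
  calc P.kernel n z A = 2 ^ (n + 1) * (((2 : ℝ≥0∞)⁻¹ ^ (n + 1) • P.kernel n z) A) := by
        rw [Measure.smul_apply, smul_eq_mul, ← mul_assoc, ← mul_pow, ENNReal.mul_inv_cancel] <;>
          simp
    _ ≤ _ := by
        gcongr
        exact ENNReal.le_tsum (f := fun n : ℕ => ((2 : ℝ≥0∞)⁻¹ ^ (n + 1) • P.kernel n z) A) n

theorem occupation_bind_le (z : E) :
    (P.occupation z).bind (P.kernel 1) ≤ (2 : ℝ≥0∞) • P.occupation z :=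
  Measure.le_iff.2 fun A hA => by
    rw [Measure.bind_apply hA (P.kernel 1).aemeasurable, Measure.smul_apply, occupation,
      lintegral_sum_measure, Measure.sum_apply _ hA, smul_eq_mul, ← ENNReal.tsum_mul_left]
    calc _ = ∑' n : ℕ, 2 * (((2 : ℝ≥0∞)⁻¹ ^ (n + 1 + 1)) • P.kernel ((n + 1 : ℕ) : ℝ≥0) z) A := by
          congr with n
          rw [lintegral_smul_measure, ← Measure.bind_apply hA (P.kernel 1).aemeasurable,
            ← kernel_add_apply, Measure.smul_apply, smul_eq_mul, smul_eq_mul, ← mul_assoc,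
            pow_succ' _ (n + 1), ← mul_assoc, ENNReal.mul_inv_cancel] <;> simp
      _ ≤ _ := ENNReal.tsum_comp_le_tsum_of_injective (add_left_injective 1)
          fun n : ℕ => 2 * (((2 : ℝ≥0∞)⁻¹ ^ (n + 1)) • P.kernel n z) A

end Occupation

variable [MetricSpace E] [MeasurableSpace E] [BorelSpace E] (P : MarkovFellerSemigroup E)

/-- The points from which the law at time `t` dominates, up to `η`, the law at time `t` started
from `z`. Testing only with continuous functions makes this set closed by the Feller property. -/
def dominatingSet (t : ℝ≥0) (z : E) (η : ℝ≥0∞) : Set E :=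
  {x | ∀ f : E →ᵇ ℝ≥0, (∀ y, f y ≤ 1) →
    ∫⁻ y, f y ∂P.kernel t z ≤ ∫⁻ y, f y ∂P.kernel t x + η}

theorem isClosed_dominatingSet (t : ℝ≥0) (z : E) (η : ℝ≥0∞) :
    IsClosed (P.dominatingSet t z η) := by
  simp only [dominatingSet, Set.ofPred_forall]
  exact isClosed_iInter fun f => isClosed_iInter fun hf =>
    isClosed_le continuous_const ((P.continuous_lintegral_kernel t f hf).add continuous_const)

theorem kernel_le_of_mem_dominatingSet {t : ℝ≥0} {z x : E} {η : ℝ≥0∞}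
    (hx : x ∈ P.dominatingSet t z η) {A : Set E} (hA : MeasurableSet A) :
    P.kernel t z A ≤ P.kernel t x A + η := by
  have hclosed : ∀ K, IsClosed K → P.kernel t z K ≤ P.kernel t x K + η := fun K hK =>
    ge_of_tendsto' ((HasOuterApproxClosed.tendsto_lintegral_apprSeq hK (P.kernel t x)).add_const η)
      fun n => (HasOuterApproxClosed.measure_le_lintegral hK _ n).trans
        (hx _ (HasOuterApproxClosed.apprSeq_apply_le_one hK n))
  rw [hA.measure_eq_iSup_isClosed_of_ne_top (measure_ne_top _ _)]
  refine iSup₂_le fun K hKA => iSup_le fun hK => (hclosed K hK).trans ?_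
  gcongr

/-- If all laws merge, then by the Baire category theorem they do so uniformly on a nonempty
relatively open subset of the support of any given nonzero measure `π`. -/
theorem exists_ball_inter_support_subset [PolishSpace E] {z : E} {η : ℝ≥0∞}
    (h : ∀ x, ∃ n : ℕ, DominatedUpTo η (P.kernel n z) (P.kernel n x)) {π : Measure E}
    (hπ : π ≠ 0) :
    ∃ k : ℕ, ∃ w ∈ π.support, ∃ r > 0, Metric.ball w r ∩ π.support ⊆ P.dominatingSet k z η := by
  have hcl : IsClosed π.support := Measure.isClosed_support
  have : PolishSpace π.support := hcl.polishSpace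
  have : Nonempty π.support := (Measure.nonempty_support hπ).to_subtype
  have hBaire : BaireSpace π.support := by
    let := TopologicalSpace.upgradeIsCompletelyMetrizable π.support
    infer_instance
  obtain ⟨k, ⟨w, hw⟩, hwk⟩ := nonempty_interior_of_iUnion_of_closed
    (f := fun k : ℕ => ((↑) : π.support → E) ⁻¹' P.dominatingSet k z η)
    (fun k => (P.isClosed_dominatingSet k z η).preimage continuous_subtype_val) (by
      ext x
      simp only [Set.mem_iUnion, Set.mem_preimage, Set.mem_univ, iff_true]
      obtain ⟨n, hn⟩ := h x
      exact ⟨n, fun f hf => hn _ (by fun_prop) fun y => by exact_mod_cast hf y⟩)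
  rw [mem_interior_iff_mem_nhds, Metric.mem_nhds_iff] at hwk
  obtain ⟨r, hr, hsub⟩ := hwk
  refine ⟨k, w, hw, r, hr, fun x hx => hsub (a := ⟨x, hx.2⟩) ?_⟩
  exact hx.1

/-- An open set reached from `z` with positive probability has probability bounded below at all
large times, as soon as this holds for the balls around `z`. -/
theorem exists_eventually_le_kernel {z : E}
    (hz : ∀ ε > 0, ∃ α : ℝ≥0∞, α ≠ 0 ∧ ∀ᶠ n : ℕ in atTop, α ≤ P.kernel n z (Metric.ball z ε))
    {O : Set E} (hO : IsOpen O) {j : ℕ} (hj : P.kernel j z O ≠ 0) :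
    ∃ β : ℝ≥0∞, β ≠ 0 ∧ ∀ᶠ n : ℕ in atTop, β ≤ P.kernel n z O := by
  have hlt : P.kernel j z Oᶜ < 1 := by
    rw [prob_compl_eq_one_sub hO.measurableSet]
    exact ENNReal.sub_lt_self ENNReal.one_ne_top one_ne_zero hj
  obtain ⟨b, hb, hb1⟩ := exists_between hlt
  have hcl : IsClosed Oᶜ := hO.isClosed_compl
  obtain ⟨i, hi⟩ := ((HasOuterApproxClosed.tendsto_lintegral_apprSeq hcl
    (P.kernel j z)).eventually (gt_mem_nhds hb)).exists
  have hcont := P.continuous_lintegral_kernel j _ (HasOuterApproxClosed.apprSeq_apply_le_one hcl i)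
  obtain ⟨ε, hε, hball⟩ := Metric.eventually_nhds_iff_ball.1
    (hcont.continuousAt.eventually (gt_mem_nhds hi))
  have hlow : ∀ x ∈ Metric.ball z ε, 1 - b ≤ P.kernel j x O := fun x hx => by
    have h1 := (HasOuterApproxClosed.measure_le_lintegral hcl (P.kernel j x) i).trans (hball x hx).le
    rw [prob_compl_eq_one_sub hO.measurableSet, tsub_le_iff_left] at h1
    rwa [tsub_le_iff_right]
  obtain ⟨α, hα, hev⟩ := hz ε hε
  refine ⟨(1 - b) * α, mul_ne_zero (tsub_pos_of_lt hb1).ne' hα, ?_⟩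
  obtain ⟨N, hN⟩ := eventually_atTop.1 hev
  refine eventually_atTop.2 ⟨N + j, fun n hn => ?_⟩
  obtain ⟨m, rfl⟩ : ∃ m, n = m + j := ⟨n - j, by omega⟩
  rw [Nat.cast_add, kernel_add_apply, Measure.bind_apply hO.measurableSet (P.kernel _).aemeasurable]
  calc (1 - b) * α ≤ (1 - b) * P.kernel m z (Metric.ball z ε) := by
        gcongr; exact hN m (by omega)
    _ = ∫⁻ _ in Metric.ball z ε, (1 - b) ∂P.kernel m z := (setLIntegral_const _ _).symm
    _ ≤ ∫⁻ x in Metric.ball z ε, P.kernel j x O ∂P.kernel m z :=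
        setLIntegral_mono' Metric.isOpen_ball.measurableSet hlow
    _ ≤ _ := setLIntegral_le_lintegral _ _

/-- If all laws merge and `z` is uniformly recurrent for its own trajectory, then the trajectory
from `z` keeps a nontrivial part below a fixed multiple of its occupation measure: the law at some
time `k` started from a frequently visited set overlaps with the one started from `z`. -/
theorem exists_eventually_le_inf_occupation [PolishSpace E] {z : E}
    (h : ∀ x, ∃ n : ℕ, DominatedUpTo 2⁻¹ (P.kernel n z) (P.kernel n x))
    (hz : ∀ ε > 0, ∃ α : ℝ≥0∞, α ≠ 0 ∧ ∀ᶠ n : ℕ in atTop, α ≤ P.kernel n z (Metric.ball z ε)) :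
    ∃ K : ℕ, ∃ γ : ℝ≥0∞, γ ≠ 0 ∧ ∀ᶠ n : ℕ in atTop,
      γ ≤ (P.kernel n z ⊓ ((2 : ℝ≥0∞) ^ K • P.occupation z)) Set.univ := by
  set π := P.occupation z with hπ
  obtain ⟨k, w, hw, r, hr, hsub⟩ := P.exists_ball_inter_support_subset h
    (IsProbabilityMeasure.ne_zero π)
  set O := Metric.ball w r with hO
  have hOm : MeasurableSet O := Metric.isOpen_ball.measurableSet
  set V := O ∩ π.support with hV
  have hVm : MeasurableSet V := hOm.inter Measure.isClosed_support.measurableSet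
  have hπO : π O ≠ 0 := ((Measure.mem_support_iff_forall w).1 hw O (Metric.ball_mem_nhds w hr)).ne'
  obtain ⟨j, hj⟩ : ∃ j : ℕ, P.kernel j z O ≠ 0 := by
    by_contra! hcon
    apply hπO
    rw [hπ, occupation, Measure.sum_apply _ hOm]
    simp [hcon]
  obtain ⟨β, hβ, hev⟩ := P.exists_eventually_le_kernel hz Metric.isOpen_ball hj
  have hβV : ∀ᶠ n : ℕ in atTop, β ≤ P.kernel n z V := hev.mono fun n hn => by
    have h0 : P.kernel n z π.supportᶜ = 0 := by
      refine le_antisymm ((P.kernel_le_occupation z n _).trans ?_) zero_le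
      rw [Measure.smul_apply, ← hπ, Measure.measure_compl_support, smul_zero]
    rwa [hV, measure_inter_conull h0]
  obtain ⟨N, hN⟩ := eventually_atTop.1 hβV
  refine ⟨k + 1, β * 2⁻¹, mul_ne_zero hβ (by simp), eventually_atTop.2 ⟨N + k, fun n hn => ?_⟩⟩
  obtain ⟨m, rfl⟩ : ∃ m, n = m + k := ⟨n - k, by omega⟩
  have hβm := hN m (by omega)
  have hβ1 : β ≤ 1 := hβm.trans prob_le_one
  have key : ∀ A, MeasurableSet A → β * (P.kernel k z A - 2⁻¹) ≤ P.kernel (m + k : ℕ) z A :=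
    fun A hA => by
      rw [Nat.cast_add, kernel_add_apply, Measure.bind_apply hA (P.kernel _).aemeasurable]
      calc β * (P.kernel k z A - 2⁻¹) ≤ (P.kernel k z A - 2⁻¹) * P.kernel m z V := by
            rw [mul_comm]; gcongr
        _ = ∫⁻ _ in V, (P.kernel k z A - 2⁻¹) ∂P.kernel m z := (setLIntegral_const _ _).symm
        _ ≤ ∫⁻ x in V, P.kernel k x A ∂P.kernel m z := setLIntegral_mono' hVm fun x hx =>
            tsub_le_iff_right.2 (P.kernel_le_of_mem_dominatingSet (hsub hx) hA)
        _ ≤ _ := setLIntegral_le_lintegral _ _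
  rw [Measure.inf_apply .univ]
  refine le_sInf ?_
  rintro _ ⟨t, rfl⟩
  rw [Set.inter_univ, Set.inter_univ]
  set A := toMeasurable (P.kernel (m + k : ℕ) z) t with hA
  have hAm : MeasurableSet A := measurableSet_toMeasurable _ _
  calc β * 2⁻¹ = β * (1 - 2⁻¹) := by rw [ENNReal.one_sub_inv_two]
    _ ≤ β * ((P.kernel k z A - 2⁻¹) + P.kernel k z Aᶜ) := by
        gcongr
        rw [tsub_le_iff_right, ← prob_add_prob_compl (μ := P.kernel k z) hAm, add_right_comm]
        gcongr
        exact le_tsub_add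
    _ = β * (P.kernel k z A - 2⁻¹) + β * P.kernel k z Aᶜ := mul_add _ _ _
    _ ≤ P.kernel (m + k : ℕ) z A + ((2 : ℝ≥0∞) ^ (k + 1) • π) Aᶜ := by
        gcongr
        · exact key A hAm
        · exact (mul_le_of_le_one_left zero_le hβ1).trans (P.kernel_le_occupation z k _)
    _ ≤ _ := by
        rw [hA, measure_toMeasurable]
        gcongr
        exact subset_toMeasurable _ _

/-- A semigroup whose laws all merge has an invariant probability measure as soon as some point is
uniformly recurrent for its own trajectory. -/
theorem exists_isInvariant [PolishSpace E] {z : E}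
    (h : ∀ (ν₁ ν₂ : Measure E) [IsProbabilityMeasure ν₁] [IsProbabilityMeasure ν₂] (δ : ℝ≥0∞),
      δ ≠ 0 → ∃ n : ℕ, DominatedUpTo δ (ν₁.bind (P.kernel n)) (ν₂.bind (P.kernel n)))
    (hz : ∀ ε > 0, ∃ α : ℝ≥0∞, α ≠ 0 ∧ ∀ᶠ n : ℕ in atTop, α ≤ P.kernel n z (Metric.ball z ε)) :
    ∃ μ : ProbabilityMeasure E, P.IsInvariant μ := by
  have hdirac : ∀ (x : E) (n : ℕ), (Measure.dirac x).bind (P.kernel n) = P.kernel n x :=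
    fun x n => Measure.dirac_bind (P.kernel n).measurable x
  obtain ⟨K, γ, hγ, hK⟩ := P.exists_eventually_le_inf_occupation (z := z) (fun x => by
    simpa only [hdirac] using h (Measure.dirac z) (Measure.dirac x) 2⁻¹ (by simp)) hz
  obtain ⟨m, hm, hinv⟩ := exists_invariant_of_le_inf (P.kernel 1) (fun n : ℕ => P.kernel n z)
    (fun n => by rw [← kernel_add_apply, Nat.cast_add, Nat.cast_one])
    (fun δ hδ => by
      obtain ⟨N, hN⟩ := h (P.kernel 1 z) (Measure.dirac z) δ hδ
      refine eventually_atTop.2 ⟨N, fun n hn => ?_⟩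
      have := hN.bind_kernel_of_le P (t := n) (by exact_mod_cast hn)
      rwa [hdirac, ← kernel_add_apply, add_comm, ← Nat.cast_one, ← Nat.cast_add] at this)
    (P.occupation z) (P.occupation_bind_le z) K hγ hK
  -- Invariance for the unit time step, hence for all integer times.
  have hnat : ∀ n : ℕ, m.bind (P.kernel n) = m := fun n => by
    induction n with
    | zero =>
      rw [Nat.cast_zero, P.kernel_zero]
      exact Measure.bind_dirac
    | succ n ih => rw [Nat.cast_add, Nat.cast_one, bind_kernel_add, ih, hinv]
  -- Both `m` and its image at time `t` are fixed at integer times, and they merge.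
  have hle : ∀ (ν₁ ν₂ : Measure E) [IsProbabilityMeasure ν₁] [IsProbabilityMeasure ν₂],
      (∀ n : ℕ, ν₁.bind (P.kernel n) = ν₁) → (∀ n : ℕ, ν₂.bind (P.kernel n) = ν₂) → ν₁ ≤ ν₂ := by
    intro ν₁ ν₂ _ _ h₁ h₂
    refine measure_le_of_forall_dominatedUpTo fun δ hδ => ?_
    obtain ⟨n, hn⟩ := h ν₁ ν₂ δ hδ
    rwa [h₁, h₂] at hn
  refine ⟨⟨m, hm⟩, fun t => Subtype.ext ?_⟩
  change m.bind (P.kernel t) = m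
  have ht : ∀ n : ℕ, (m.bind (P.kernel t)).bind (P.kernel n) = m.bind (P.kernel t) := fun n => by
    rw [← bind_kernel_add, add_comm, bind_kernel_add, hnat]
  exact le_antisymm (hle _ _ ht hnat) (hle _ _ hnat ht)

end MarkovFellerSemigroup

/-! ### The equivalence -/

namespace MarkovFellerSemigroup

variable {E : Type*} [MetricSpace E] [MeasurableSpace E] (P : MarkovFellerSemigroup E)

theorem TVEventuallyContinuousAt.exists_ball {P : MarkovFellerSemigroup E} {z : E}
    (h : P.TVEventuallyContinuousAt z) {η : ℝ≥0∞} (hη : η ≠ 0) :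
    ∃ ε > 0, ∀ x ∈ Metric.ball z ε, ∃ n : ℕ, DominatedUpTo η (P.kernel n x) (P.kernel n z) := by
  obtain ⟨ε, hε, hball⟩ := Metric.eventually_nhds_iff_ball.1
    (eventually_lt_of_limsup_lt (lt_of_eq_of_lt h (pos_iff_ne_zero.2 hη)))
  refine ⟨ε, hε, fun x hx => ?_⟩
  obtain ⟨t, ht⟩ := (eventually_lt_of_limsup_lt (hball x hx)).exists
  exact ⟨⌈t⌉₊, (dominatedUpTo_of_iSup_le ht.le).kernel_of_le P (Nat.le_ceil t)⟩

/-- Under the hypotheses of total variation eventual continuity at `z` and uniform recurrence to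
the balls around `z`, all laws merge. -/
theorem exists_dominatedUpTo [BorelSpace E] {z : E} (hTV : P.TVEventuallyContinuousAt z)
    (hz : ∀ ε : ℝ, 0 < ε → ∃ θ : ℝ≥0∞, θ ≠ 0 ∧ θ < 1 ∧
      ∀ (ν : Measure E) [IsProbabilityMeasure ν], ∀ᶠ n : ℕ in atTop,
        θ ≤ ν.bind (P.kernel n) (Metric.ball z ε))
    (ν₁ ν₂ : Measure E) [IsProbabilityMeasure ν₁] [IsProbabilityMeasure ν₂] {δ : ℝ≥0∞}
    (hδ : δ ≠ 0) : ∃ n : ℕ, DominatedUpTo δ (ν₁.bind (P.kernel n)) (ν₂.bind (P.kernel n)) := by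
  have hη : δ / 5 ≠ 0 := ENNReal.div_ne_zero.2 ⟨hδ, by simp⟩
  obtain ⟨ε, hε, hball⟩ := hTV.exists_ball hη
  obtain ⟨θ, hθ0, hθ1, hθ⟩ := hz ε hε
  obtain ⟨n, hn⟩ := P.exists_dominatedUpTo_of_step Metric.isOpen_ball.measurableSet hη hball
    hθ0 hθ1 hθ ν₁ ν₂
  exact ⟨n, hn.mono (ENNReal.mul_div_le)⟩

/-- Uniform recurrence to `B` from all points yields a lower bound on the mass that the law started
from any initial distribution eventually gives to `B`. -/
theorem exists_le_bind_kernel_of_iInf_liminf_pos {B : Set E} (hBm : MeasurableSet B)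
    (h : 0 < ⨅ x : E, liminf (fun t : ℝ≥0 => P.kernel t x B) atTop) :
    ∃ θ : ℝ≥0∞, θ ≠ 0 ∧ θ < 1 ∧ ∀ (ν : Measure E) [IsProbabilityMeasure ν],
      ∀ᶠ n : ℕ in atTop, θ ≤ ν.bind (P.kernel n) B := by
  obtain ⟨θ, hθ0, hθ⟩ := exists_between (lt_min h one_pos)
  refine ⟨θ, hθ0.ne', hθ.trans_le (min_le_right _ _), fun ν _ =>
    P.eventually_le_bind_kernel hBm (fun x => (iInf_le _ x).trans ?_)
      (hθ.trans_le (min_le_left _ _)) ν⟩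
  exact liminf_le_liminf_of_le (u := fun t : ℝ≥0 => P.kernel t x B)
    (tendsto_natCast_atTop_atTop : Tendsto ((↑) : ℕ → ℝ≥0) atTop atTop)

theorem dominatedUpTo_kernel_of_tvDist (t : ℝ≥0) (x : E) (μ : ProbabilityMeasure E) :
    DominatedUpTo (2 * tvDist (P.dual t ⟨Measure.dirac x, inferInstance⟩) μ)
      (P.kernel t x) (μ : Measure E) := by
  have h := dominatedUpTo_two_mul_tvDist (P.dual t ⟨Measure.dirac x, inferInstance⟩) μ
  rwa [show ((P.dual t ⟨Measure.dirac x, inferInstance⟩ : ProbabilityMeasure E) : Measure E) =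
    P.kernel t x from Measure.dirac_bind (P.kernel t).measurable x] at h

theorem tvEventuallyContinuousAt_of_tendsto {μ : ProbabilityMeasure E}
    (hμ : ∀ ν : ProbabilityMeasure E,
      Tendsto (fun t : ℝ≥0 => tvDist (P.dual t ν) μ) atTop (𝓝 0)) (z : E) :
    P.TVEventuallyContinuousAt z := by
  have hlim : ∀ x, limsup (fun t : ℝ≥0 => ⨆ f ∈ unitBorelFunctions E,
      ENNReal.ofReal |P.act t f x - P.act t f z|) atTop = 0 := fun x => by
    refine Tendsto.limsup_eq ?_
    have hx := (ENNReal.Tendsto.const_mul (hμ ⟨Measure.dirac x, inferInstance⟩)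
      (Or.inr (by simp : (2 : ℝ≥0∞) ≠ ∞)))
    have hz := (ENNReal.Tendsto.const_mul (hμ ⟨Measure.dirac z, inferInstance⟩)
      (Or.inr (by simp : (2 : ℝ≥0∞) ≠ ∞)))
    have hxz := ENNReal.Tendsto.const_mul (hx.add hz) (Or.inr (by simp : (2 : ℝ≥0∞) ≠ ∞))
    simp only [mul_zero, add_zero] at hxz
    exact tendsto_of_tendsto_of_tendsto_of_le_of_le tendsto_const_nhds hxz (fun _ => zero_le)
      fun t => ((P.dominatedUpTo_kernel_of_tvDist t x μ).trans
        (P.dominatedUpTo_kernel_of_tvDist t z μ).symm).iSup_le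
  simp only [TVEventuallyContinuousAt, hlim]
  exact tendsto_const_nhds.limsup_eq

theorem iInf_liminf_kernel_pos_of_tendsto {μ : ProbabilityMeasure E}
    (hμ : ∀ ν : ProbabilityMeasure E,
      Tendsto (fun t : ℝ≥0 => tvDist (P.dual t ν) μ) atTop (𝓝 0)) {B : Set E}
    (hBm : MeasurableSet B) (hB : (μ : Measure E) B ≠ 0) :
    0 < ⨅ x : E, liminf (fun t : ℝ≥0 => P.kernel t x B) atTop := by
  have hBt : (μ : Measure E) B ≠ ∞ := measure_ne_top _ _
  refine (ENNReal.half_pos hB).trans_le (le_iInf fun x => le_liminf_of_le ?_ ?_)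
  · isBoundedDefault
  · have hx := (ENNReal.Tendsto.const_mul (hμ ⟨Measure.dirac x, inferInstance⟩)
      (Or.inr (by simp : (2 : ℝ≥0∞) ≠ ∞)))
    rw [mul_zero] at hx
    filter_upwards [hx.eventually (ge_mem_nhds (ENNReal.half_pos hB))] with t ht
    have h := (P.dominatedUpTo_kernel_of_tvDist t x μ).symm.measure_le hBm
    refine ENNReal.le_of_add_le_add_right (a := (μ : Measure E) B / 2)
      (ENNReal.div_ne_top hBt (by simp)) ?_
    rw [ENNReal.add_halves]
    exact h.trans (by gcongr)

end MarkovFellerSemigroup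

theorem theorem2p1 {E : Type*} [MetricSpace E] [PolishSpace E] [MeasurableSpace E] [BorelSpace E]
    (P : MarkovFellerSemigroup E) :
    (∃ μ : ProbabilityMeasure E,
      P.IsInvariant μ ∧ (∀ μ' : ProbabilityMeasure E, P.IsInvariant μ' → μ' = μ) ∧
      ∀ ν : ProbabilityMeasure E,
        Tendsto (fun t : ℝ≥0 => tvDist (P.dual t ν) μ) atTop (𝓝 0)) ↔
    ∃ z : E, P.TVEventuallyContinuousAt z ∧
      ∀ ε : ℝ, 0 < ε →
        0 < ⨅ x : E, liminf (fun t : ℝ≥0 => P.kernel t x (Metric.ball z ε)) atTop := by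
  constructor
  · rintro ⟨μ, -, -, hμ⟩
    obtain ⟨z, hz⟩ := Measure.nonempty_support (IsProbabilityMeasure.ne_zero (μ : Measure E))
    refine ⟨z, P.tvEventuallyContinuousAt_of_tendsto hμ z, fun ε hε =>
      P.iInf_liminf_kernel_pos_of_tendsto hμ Metric.isOpen_ball.measurableSet ?_⟩
    exact ((Measure.mem_support_iff_forall z).1 hz _ (Metric.ball_mem_nhds z hε)).ne'
  · rintro ⟨z, hTV, hz⟩
    have hθ := fun (ε : ℝ) (hε : 0 < ε) =>
      P.exists_le_bind_kernel_of_iInf_liminf_pos Metric.isOpen_ball.measurableSet (hz ε hε)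
    have hmerge := fun (ν₁ ν₂ : Measure E) [IsProbabilityMeasure ν₁] [IsProbabilityMeasure ν₂]
      (δ : ℝ≥0∞) (hδ : δ ≠ 0) => P.exists_dominatedUpTo hTV hθ ν₁ ν₂ hδ
    obtain ⟨μ, hμ⟩ := P.exists_isInvariant hmerge (z := z) fun ε hε => by
      obtain ⟨θ, hθ0, -, h⟩ := hθ ε hε
      refine ⟨θ, hθ0, (h (Measure.dirac z)).mono fun n hn => ?_⟩
      rwa [Measure.dirac_bind (P.kernel n).measurable] at hn
    have hfix : ∀ ν : ProbabilityMeasure E, P.IsInvariant ν → ∀ t : ℝ≥0,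
        (ν : Measure E).bind (P.kernel t) = ν := fun ν hν t => congrArg Subtype.val (hν t)
    have hconv : ∀ (ν : ProbabilityMeasure E) (δ : ℝ≥0∞), δ ≠ 0 → ∀ᶠ t : ℝ≥0 in atTop,
        DominatedUpTo δ (P.dual t ν : Measure E) (μ : Measure E) := fun ν δ hδ => by
      obtain ⟨n, hn⟩ := hmerge ν μ δ hδ
      filter_upwards [eventually_ge_atTop (n : ℝ≥0)] with t ht
      have h := hn.bind_kernel_of_le P ht
      rwa [hfix μ hμ] at h
    refine ⟨μ, hμ, fun μ' hμ' => ?_, fun ν => ENNReal.tendsto_nhds_zero.2 fun δ hδ =>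
      (hconv ν δ hδ.ne').mono fun t ht => ht.tvDist_le⟩
    have hdom : ∀ δ : ℝ≥0∞, δ ≠ 0 → DominatedUpTo δ (μ' : Measure E) (μ : Measure E) :=
      fun δ hδ => by
        obtain ⟨t, ht⟩ := (hconv μ' δ hδ).exists
        rwa [hμ' t] at ht
    exact Subtype.ext (le_antisymm (measure_le_of_forall_dominatedUpTo hdom)
      (measure_le_of_forall_dominatedUpTo fun δ hδ => (hdom δ hδ).symm))
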